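/- Let $G$ be a finite, connected, simple graph that is outerplanar, i.e. $G$ can be embedded in the plane (vertices as distinct points, edges as simple arcs meeting only at common endpoints) so that every vertex lies on the boundary of the outer (unbounded) face. Then the fully active cop number of $G$ satisfies $c_a(G) \le 2$. Here $c_a(G)$ is the least number $k$ such that $k$ cops have a winning strategy in the following game on $G$. The cops first choose starting vertices (several cops may share a vertex), then the robber chooses his. The two sides then alternate turns, the cops first: on a cop turn every cop must move to a vertex adjacent to her current one, and on a robber turn the robber must move to a vertex adjacent to his current one; nobody may remain in place. The cops win if at some moment a cop occupies the same vertex as the robber; the robber wins if he avoids this forever. -/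

import Mathlib

/-! ### Plane embeddings and outerplanar graphs -/

/-- A subset `A` of the plane `ℂ` is a (simple) arc with ends `a` and `b`. -/
def IsPlaneArc (A : Set ℂ) (a b : ℂ) : Prop :=
  ∃ γ : Path a b, Function.Injective γ ∧ Set.range γ = A

/-- An embedding (crossing-free drawing) of the simple graph `G` in the plane `ℂ`: distinct vertices
are distinct points, every edge `s(u, v)` is an arc joining the points of `u` and `v` that contains
no other vertex point, and two different edges meet at most in vertex points (hence at most in
common ends). The value of `arc` outside the edge set is irrelevant. -/
structure PlaneEmbedding {V : Type*} (G : SimpleGraph V) where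
  point : V → ℂ
  arc : Sym2 V → Set ℂ
  point_injective : Function.Injective point
  isPlaneArc : ∀ u v : V, G.Adj u v → IsPlaneArc (arc s(u, v)) (point u) (point v)
  eq_or_eq_of_point_mem_arc : ∀ u v w : V, G.Adj u v → point w ∈ arc s(u, v) → w = u ∨ w = v
  arc_inter_arc_subset : ∀ e ∈ G.edgeSet, ∀ f ∈ G.edgeSet, e ≠ f →
    arc e ∩ arc f ⊆ Set.range point

namespace PlaneEmbedding

/-- The point set of the drawing: all vertex points and all edge arcs. -/
def support {V : Type*} {G : SimpleGraph V} (E : PlaneEmbedding G) : Set ℂ :=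
  Set.range E.point ∪ ⋃ e ∈ G.edgeSet, E.arc e

/-- The outer face: the union of the unbounded connected components of the complement of the
drawing (for a finite graph there is exactly one). -/
def outerFace {V : Type*} {G : SimpleGraph V} (E : PlaneEmbedding G) : Set ℂ :=
  {z | z ∈ E.supportᶜ ∧ ¬ Bornology.IsBounded (connectedComponentIn E.supportᶜ z)}

end PlaneEmbedding

/-- `G` is outerplanar: it can be embedded in the plane so that every vertex lies on the boundary
of the outer face. -/
def IsOuterplanar {V : Type*} (G : SimpleGraph V) : Prop :=
  ∃ E : PlaneEmbedding G, ∀ v : V, E.point v ∈ frontier E.outerFace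

/-! ### The fully active game of Cops and Robbers -/

/-- `CopsForceCapture G c r`: with `k` cops at the positions `c`, the robber at `r`, and the cops to
move, the cops have a strategy that captures the robber after finitely many moves. A derivation of
this proposition is such a strategy, presented as a well-founded tree.

In each turn every cop moves to a vertex adjacent to her current one, and then the robber moves to a
vertex adjacent to his current one; nobody may stay in place. Several cops may share a vertex. The
robber is captured as soon as some cop is on his vertex. If a player who has to move has no legal
move, no capture takes place, which does not count as a win of the cops. -/
inductive CopsForceCapture {V : Type*} (G : SimpleGraph V) {k : ℕ} : (Fin k → V) → V → Prop
  /-- Some cop is already on the robber's vertex. -/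
  | captured (c : Fin k → V) (r : V) (i : Fin k) (h : c i = r) : CopsForceCapture G c r
  /-- The cops move to `c'`, and cop `i` thereby captures the robber. -/
  | capture (c c' : Fin k → V) (r : V) (hc : ∀ j, G.Adj (c j) (c' j)) (i : Fin k) (h : c' i = r) :
      CopsForceCapture G c r
  /-- The cops move to `c'`, from where they force a capture whatever the robber's move is. -/
  | move (c c' : Fin k → V) (r : V) (hc : ∀ j, G.Adj (c j) (c' j)) (hr : ∃ r', G.Adj r r')
      (h : ∀ r', G.Adj r r' → CopsForceCapture G c' r') : CopsForceCapture G c r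

/-- `k` cops have a winning strategy in the fully active game on `G`: they can choose initial
positions such that, wherever the robber then starts, they (moving first) force a capture. -/
def CopsHaveWinningStrategy {V : Type*} (G : SimpleGraph V) (k : ℕ) : Prop :=
  ∃ c : Fin k → V, ∀ r : V, CopsForceCapture G c r

/-- The fully active cop number: the least `k` such that `k` cops have a winning strategy in the
fully active game on `G` (and `⊤` if there is no such `k`). -/
noncomputable def fullyActiveCopNumber {V : Type*} (G : SimpleGraph V) : ℕ∞ :=
  ⨅ (k : ℕ) (_ : CopsHaveWinningStrategy G k), (k : ℕ∞)

/-! A new vertex in the outer face, joined to all vertices, would turn a `K₄` or `K₂,₃` minor of `G`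
into a drawing of `K₅` or `K₃,₃` with disjoint independent edges. A parity argument excludes this
without the Jordan curve theorem: for two disjoint arcs the difference of their points never
vanishes on a square, so its angle changes along the four sides cancel. Over all pairs of
independent edges these relations (`exists_winding`) contradict each other modulo 2.

For the game, a cop who oscillates on an edge threatens both its ends in every round, as she can
step back to the vertex just left. The robber stays confined to a connected territory `T` whose
exits are the ends of such an edge (`EdgeGuardWins`), or one end `x` of it and the other cop's
vertex `u` (`PairGuardWins`). In the first case the free cop walks to an end with a neighbour in
`T`, which gives the second case. In the second, the excluded minors yield a neighbour `u'` of `u`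
in `T` such that no component of `T \ {u'}` touches both `u` and `x` (`exists_separating_neighbor`).
The cop steps from `u` to `u'`, and the robber is left in a smaller territory of one of the two
kinds. -/

/-! ### Continuous logarithms and angle change -/

open Complex in
theorem exists_continuous_log {A : Type*} [TopologicalSpace A] [SimplyConnectedSpace A]
    [LocallyPathConnectedSpace A] {f : A → ℂ} (hf : Continuous f) (h0 : ∀ a, f a ≠ 0) :
    ∃ L : A → ℂ, Continuous L ∧ ∀ a, exp (L a) = f a := by
  obtain ⟨a₀⟩ : Nonempty A := inferInstance
  obtain ⟨L, ⟨-, hL⟩, -⟩ := isCoveringMapOn_exp.existsUnique_continuousMap_lifts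
    (⟨f, hf⟩ : C(A, ℂ)) (exp_log (h0 a₀)) h0
  exact ⟨L, L.continuous, fun a => congrFun hL a⟩

open Complex in
-- After a constant shift by a period, both are lifts of one map through `exp` that agree at `0`, so
-- they coincide.
theorem log_change_unique {L M : ℝ → ℂ} (hL : Continuous L) (hM : Continuous M)
    (h : ∀ t, exp (L t) = exp (M t)) : L 1 - L 0 = M 1 - M 0 := by
  have h1 : exp (L 0 - M 0) = 1 := by rw [exp_sub, h, div_self (exp_ne_zero _)]
  have key : L = fun t => M t + (L 0 - M 0) := by
    refine isCoveringMap_exp.eq_of_comp_eq hL (by fun_prop) ?_ 0 (by ring)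
    exact funext fun t => Subtype.ext (by simp [exp_add, h1, h])
  have := congrFun key 1
  linear_combination this

open Classical in
/-- The total change of a continuous logarithm of `f` along `[0, 1]`. -/
noncomputable def logChange (f : ℝ → ℂ) : ℂ :=
  if h : ∃ L : ℝ → ℂ, Continuous L ∧ ∀ t, Complex.exp (L t) = f t then
    h.choose 1 - h.choose 0 else 0

theorem logChange_eq {f L : ℝ → ℂ} (hL : Continuous L) (h : ∀ t, Complex.exp (L t) = f t) :
    logChange f = L 1 - L 0 := by
  have H : ∃ L : ℝ → ℂ, Continuous L ∧ ∀ t, Complex.exp (L t) = f t := ⟨L, hL, h⟩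
  rw [logChange, dif_pos H]
  exact log_change_unique H.choose_spec.1 hL fun t => by rw [H.choose_spec.2, h]

/-- The ends thus determine the angle change modulo `2πi`; the remaining integer is the unknown of
the parity argument. -/
theorem exp_logChange {f : ℝ → ℂ} (hf : Continuous f) (h0 : ∀ t, f t ≠ 0) :
    Complex.exp (logChange f) = f 1 / f 0 := by
  obtain ⟨L, hL, h⟩ := exists_continuous_log hf h0
  rw [logChange_eq hL h, Complex.exp_sub, h, h]

theorem extend_mem_range {X : Type*} [TopologicalSpace X] {a b : X} (γ : Path a b) (t : ℝ) :
    γ.extend t ∈ Set.range γ := by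
  rw [← γ.extend_range]; exact ⟨t, rfl⟩

/-- The sum of the angle changes around the boundary of the square on which the difference of two
disjoint paths is defined vanishes. -/
theorem logChange_square {a b c d : ℂ} (γ : Path a b) (δ : Path c d)
    (h : Disjoint (Set.range γ) (Set.range δ)) :
    logChange (fun t => δ.extend t - a) + logChange (fun s => γ.extend s - d) =
      logChange (fun s => γ.extend s - c) + logChange (fun t => δ.extend t - b) := by
  have h0 : ∀ p : ℝ × ℝ, δ.extend p.2 - γ.extend p.1 ≠ 0 := fun p hp =>
    Set.disjoint_left.1 h (extend_mem_range γ p.1)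
      (by rw [← sub_eq_zero.1 hp]; exact extend_mem_range δ p.2)
  obtain ⟨L, hL, hexp⟩ := exists_continuous_log (A := ℝ × ℝ)
    (f := fun p => δ.extend p.2 - γ.extend p.1) (by fun_prop) h0
  rw [logChange_eq (f := fun t => δ.extend t - a) (L := fun t => L (0, t)) (by fun_prop)
      (fun t => by simp [hexp]),
    logChange_eq (f := fun t => δ.extend t - b) (L := fun t => L (1, t)) (by fun_prop)
      (fun t => by simp [hexp]),
    -- On the sides where `γ` varies the difference appears with the opposite sign, hence the shift
    -- by `πi`.
    logChange_eq (f := fun s => γ.extend s - d) (L := fun s => L (s, 1) + Real.pi * Complex.I)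
      (by fun_prop) (fun t => by simp [hexp]),
    logChange_eq (f := fun s => γ.extend s - c) (L := fun s => L (s, 0) + Real.pi * Complex.I)
      (by fun_prop) (fun t => by simp [hexp])]
  ring

/-! ### Parity obstruction for `K₅` and `K₃,₃` -/

/-- The sign of an ordered pair of indices. -/
def orderSign {n : ℕ} (i j : Fin n) : ℤ := if i < j then 1 else -1

/-- The parity obstruction to drawing a graph in the plane with disjoint independent edges. -/
theorem exists_winding {n : ℕ} (P : Fin n → ℂ) (γ : ∀ i j, Path (P i) (P j)) :
    ∃ ν : Fin n → Fin n → Fin n → ℤ, ∀ i j k l, i < j → k < l →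
      Disjoint (Set.range (γ i j)) (Set.range (γ k l)) →
      2 * (ν i k l + ν l i j - ν j k l - ν k i j) =
        orderSign i l + orderSign k i + orderSign l j + orderSign j k := by
  -- A logarithm of `P v - P u`, normalised so that exchanging `u` and `v` changes it by exactly
  -- `±πi`, with the sign given by the order.
  let α : Fin n → Fin n → ℂ := fun u v =>
    if u < v then Complex.log (P v - P u) else Complex.log (P u - P v) + Real.pi * Complex.I
  have hα : ∀ u v, P u ≠ P v → Complex.exp (α u v) = P v - P u := by
    intro u v h
    simp only [α]
    split_ifs
    · exact Complex.exp_log (sub_ne_zero.2 h.symm)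
    · rw [Complex.exp_add, Complex.exp_pi_mul_I, Complex.exp_log (sub_ne_zero.2 h)]; ring
  have hs : ∀ u v, P u ≠ P v → α u v - α v u = -(Real.pi * Complex.I) * orderSign u v := by
    intro u v h
    have : u ≠ v := fun e => h (by rw [e])
    rcases lt_or_gt_of_ne this with h | h
    · simp [α, orderSign, h, h.not_gt]
    · simp [α, orderSign, h, h.not_gt]
  -- The integer compares the true angle change along the arc `kl`, seen from `P i`, with the one
  -- predicted by `α`; it is a dummy if the arc meets `P i`.
  have hν : ∀ i k l, ∃ m : ℤ, P i ∉ Set.range (γ k l) →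
      logChange (fun t => (γ k l).extend t - P i) =
        α i l - α i k + m * (2 * Real.pi * Complex.I) := by
    intro i k l
    by_cases hi : P i ∈ Set.range (γ k l)
    · exact ⟨0, fun h => absurd hi h⟩
    have h0 : ∀ t, (γ k l).extend t - P i ≠ 0 := fun t ht =>
      hi (by rw [← sub_eq_zero.1 ht]; exact extend_mem_range _ _)
    have hk : P i ≠ P k := fun e => hi (by rw [e]; exact ⟨0, by simp⟩)
    have hl : P i ≠ P l := fun e => hi (by rw [e]; exact ⟨1, by simp⟩)
    have := exp_logChange (f := fun t => (γ k l).extend t - P i) (by fun_prop) h0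
    have h2 : Complex.exp (logChange (fun t => (γ k l).extend t - P i)) =
        Complex.exp (α i l - α i k) := by
      rw [this, Complex.exp_sub, hα _ _ hk, hα _ _ hl]; simp
    obtain ⟨m, hm⟩ := Complex.exp_eq_exp_iff_exists_int.1 h2
    exact ⟨m, fun _ => hm⟩
  choose ν hν using hν
  refine ⟨ν, fun i j k l hij hkl hd => ?_⟩
  have m0 : ∀ a b, P a ∈ Set.range (γ a b) := fun a b => ⟨0, by simp⟩
  have m1 : ∀ a b, P b ∈ Set.range (γ a b) := fun a b => ⟨1, by simp⟩
  have hi := Set.disjoint_left.1 hd (m0 i j)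
  have hj := Set.disjoint_left.1 hd (m1 i j)
  have hk := Set.disjoint_right.1 hd (m0 k l)
  have hl := Set.disjoint_right.1 hd (m1 k l)
  have hsq := logChange_square (γ i j) (γ k l) hd
  rw [hν _ _ _ hi, hν _ _ _ hj, hν _ _ _ hk, hν _ _ _ hl] at hsq
  have e1 := hs i l fun e => hi (by rw [e]; exact m1 k l)
  have e2 := hs k i fun e => hi (by rw [← e]; exact m0 k l)
  have e3 := hs l j fun e => hj (by rw [← e]; exact m1 k l)
  have e4 := hs j k fun e => hj (by rw [e]; exact m0 k l)
  have hpi : (Real.pi * Complex.I : ℂ) ≠ 0 := by simp [Real.pi_ne_zero]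
  have key : (Real.pi * Complex.I : ℂ) * (2 * (ν i k l + ν l i j - ν j k l - ν k i j)) =
      (Real.pi * Complex.I : ℂ) *
        (orderSign i l + orderSign k i + orderSign l j + orderSign j k) := by
    linear_combination hsq - e1 - e2 - e3 - e4
  have := mul_left_cancel₀ hpi key
  exact_mod_cast this

/-- The complete graph on five vertices has no drawing with disjoint independent edges. -/
theorem not_disjoint_drawing_five (P : Fin 5 → ℂ) (γ : ∀ i j, Path (P i) (P j))
    (h : ∀ i j k l, i < j → k < l → i ≠ k → i ≠ l → j ≠ k → j ≠ l →
      Disjoint (Set.range (γ i j)) (Set.range (γ k l))) : False := by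
  obtain ⟨ν, hν⟩ := exists_winding P γ
  have H : ∀ i j k l, i < j → k < l → i ≠ k → i ≠ l → j ≠ k → j ≠ l → _ :=
    fun i j k l a b c d e f => hν i j k l a b (h i j k l a b c d e f)
  have h1 := H 0 1 2 3 (by decide) (by decide) (by decide) (by decide) (by decide) (by decide)
  have h2 := H 0 1 2 4 (by decide) (by decide) (by decide) (by decide) (by decide) (by decide)
  have h3 := H 0 1 3 4 (by decide) (by decide) (by decide) (by decide) (by decide) (by decide)
  have h4 := H 0 2 1 3 (by decide) (by decide) (by decide) (by decide) (by decide) (by decide)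
  have h5 := H 0 2 1 4 (by decide) (by decide) (by decide) (by decide) (by decide) (by decide)
  have h6 := H 0 2 3 4 (by decide) (by decide) (by decide) (by decide) (by decide) (by decide)
  have h7 := H 0 3 1 2 (by decide) (by decide) (by decide) (by decide) (by decide) (by decide)
  have h8 := H 0 3 1 4 (by decide) (by decide) (by decide) (by decide) (by decide) (by decide)
  have h9 := H 0 3 2 4 (by decide) (by decide) (by decide) (by decide) (by decide) (by decide)
  have h10 := H 0 4 1 2 (by decide) (by decide) (by decide) (by decide) (by decide) (by decide)
  have h11 := H 0 4 1 3 (by decide) (by decide) (by decide) (by decide) (by decide) (by decide)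
  have h12 := H 0 4 2 3 (by decide) (by decide) (by decide) (by decide) (by decide) (by decide)
  have h13 := H 1 2 3 4 (by decide) (by decide) (by decide) (by decide) (by decide) (by decide)
  have h14 := H 1 3 2 4 (by decide) (by decide) (by decide) (by decide) (by decide) (by decide)
  have h15 := H 1 4 2 3 (by decide) (by decide) (by decide) (by decide) (by decide) (by decide)
  -- Half the sign sum is odd exactly when the two index pairs interleave, which happens once for
  -- each of the five 4-subsets. Each `ν v k l` occurs in two equations, since two edges at `v`
  -- avoid the edge `kl`. So the halved equations add up to even = odd.
  simp [orderSign] at h1 h2 h3 h4 h5 h6 h7 h8 h9 h10 h11 h12 h13 h14 h15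
  omega

/-- The complete bipartite graph with parts `{0, 1, 5}` and `{2, 3, 4}` has no drawing with
disjoint independent edges. -/
theorem not_disjoint_drawing_three_three (P : Fin 6 → ℂ) (γ : ∀ i j, Path (P i) (P j))
    (h : ∀ i j k l, i < j → k < l → i ≠ k → i ≠ l → j ≠ k → j ≠ l →
      ((i = 0 ∨ i = 1) ∧ (j = 2 ∨ j = 3 ∨ j = 4) ∨ (i = 2 ∨ i = 3 ∨ i = 4) ∧ j = 5) →
      ((k = 0 ∨ k = 1) ∧ (l = 2 ∨ l = 3 ∨ l = 4) ∨ (k = 2 ∨ k = 3 ∨ k = 4) ∧ l = 5) →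
      Disjoint (Set.range (γ i j)) (Set.range (γ k l))) : False := by
  obtain ⟨ν, hν⟩ := exists_winding P γ
  have H := fun (i j k l : Fin 6) a b c d e f g g' => hν i j k l a b (h i j k l a b c d e f g g')
  have H1 : ∀ j ∈ ({2, 3, 4} : Finset (Fin 6)), ∀ l ∈ ({2, 3, 4} : Finset (Fin 6)), j ≠ l →
      2 * (ν 0 1 l + ν l 0 j - ν j 1 l - ν 1 0 j) =
        orderSign (0 : Fin 6) l + orderSign (1 : Fin 6) 0 + orderSign l j + orderSign j 1 := by
    intro j hj l hl hjl
    apply H <;> revert j l <;> decide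
  have H2 : ∀ i ∈ ({0, 1} : Finset (Fin 6)), ∀ j ∈ ({2, 3, 4} : Finset (Fin 6)),
      ∀ k ∈ ({2, 3, 4} : Finset (Fin 6)), j ≠ k →
      2 * (ν i k 5 + ν 5 i j - ν j k 5 - ν k i j) =
        orderSign i 5 + orderSign k i + orderSign 5 j + orderSign j k := by
    intro i hi j hj k hk hjk
    apply H <;> revert i j k <;> decide
  -- Again each `ν v k l` occurs in two equations, while 9 of the 18 pairs of independent edges
  -- interleave.
  simp [orderSign] at H1 H2
  omega

section Graph

variable {V : Type*} {G : SimpleGraph V}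

/-! ### Connected vertex sets -/

/-- One step along an edge inside the vertex set `S`. -/
def StepIn (G : SimpleGraph V) (S : Set V) (u v : V) : Prop := G.Adj u v ∧ u ∈ S ∧ v ∈ S

/-- Any two vertices of `S` are joined by a walk inside `S`. -/
def ConnectedOn (G : SimpleGraph V) (S : Set V) : Prop :=
  ∀ a ∈ S, ∀ b ∈ S, Relation.ReflTransGen (StepIn G S) a b

/-- Some edge joins `S` to `T`. -/
def AdjacentSets (G : SimpleGraph V) (S T : Set V) : Prop := ∃ a ∈ S, ∃ b ∈ T, G.Adj a b

/-- The component of `a` in the subgraph induced on `S`. -/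
def componentIn (G : SimpleGraph V) (S : Set V) (a : V) : Set V :=
  {b | Relation.ReflTransGen (StepIn G S) a b}

theorem AdjacentSets.symm {S T : Set V} (h : AdjacentSets G S T) : AdjacentSets G T S := by
  obtain ⟨a, ha, b, hb, hab⟩ := h
  exact ⟨b, hb, a, ha, hab.symm⟩

theorem StepIn.symm {S : Set V} {u v : V} (h : StepIn G S u v) : StepIn G S v u :=
  ⟨h.1.symm, h.2.2, h.2.1⟩

theorem reflTransGen_stepIn_symm {S : Set V} {a b : V}
    (h : Relation.ReflTransGen (StepIn G S) a b) : Relation.ReflTransGen (StepIn G S) b a :=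
  have : Std.Symm (StepIn G S) := ⟨fun _ _ h => h.symm⟩
  Std.Symm.symm _ _ h

theorem reflTransGen_stepIn_mono {S T : Set V} (hST : S ⊆ T) {a b : V}
    (h : Relation.ReflTransGen (StepIn G S) a b) : Relation.ReflTransGen (StepIn G T) a b :=
  Relation.ReflTransGen.mono (fun _ _ h => ⟨h.1, hST h.2.1, hST h.2.2⟩) _ _ h

theorem connectedOn_singleton (u : V) : ConnectedOn G {u} := by
  rintro a rfl b rfl
  exact .refl

theorem ConnectedOn.union {S T : Set V} (hS : ConnectedOn G S) (hT : ConnectedOn G T)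
    (h : AdjacentSets G S T) : ConnectedOn G (S ∪ T) := by
  obtain ⟨a, ha, b, hb, hab⟩ := h
  have hcross : Relation.ReflTransGen (StepIn G (S ∪ T)) a b :=
    .single ⟨hab, .inl ha, .inr hb⟩
  have hto : ∀ c ∈ S ∪ T, Relation.ReflTransGen (StepIn G (S ∪ T)) a c := by
    rintro c (hc | hc)
    · exact reflTransGen_stepIn_mono Set.subset_union_left (hS a ha c hc)
    · exact hcross.trans (reflTransGen_stepIn_mono Set.subset_union_right (hT b hb c hc))
  exact fun c hc d hd => (reflTransGen_stepIn_symm (hto c hc)).trans (hto d hd)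

theorem mem_componentIn_self {S : Set V} {a : V} : a ∈ componentIn G S a := .refl

theorem componentIn_subset {S : Set V} {a : V} (ha : a ∈ S) : componentIn G S a ⊆ S := by
  intro b hb
  induction hb with
  | refl => exact ha
  | tail _ h _ => exact h.2.2

theorem mem_componentIn_of_adj {S : Set V} {a b c : V} (hb : b ∈ componentIn G S a)
    (hbS : b ∈ S) (hc : c ∈ S) (h : G.Adj b c) : c ∈ componentIn G S a :=
  Relation.ReflTransGen.tail hb ⟨h, hbS, hc⟩

theorem connectedOn_componentIn (S : Set V) (a : V) : ConnectedOn G (componentIn G S a) := by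
  have h : ∀ b ∈ componentIn G S a,
      Relation.ReflTransGen (StepIn G (componentIn G S a)) a b := by
    intro b hb
    induction hb with
    | refl => exact .refl
    | tail hb h ih => exact ih.tail ⟨h.1, hb, hb.tail h⟩
  exact fun b hb c hc => (reflTransGen_stepIn_symm (h b hb)).trans (h c hc)

theorem ConnectedOn.exists_exit {S T : Set V} (hS : ConnectedOn G S) {a b : V} (ha : a ∈ S)
    (haT : a ∈ T) (hb : b ∈ S) (hbT : b ∉ T) :
    ∃ c ∈ S, c ∈ T ∧ ∃ d ∈ S, d ∉ T ∧ G.Adj c d := by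
  have h := hS a ha b hb
  clear hb
  induction h with
  | refl => exact absurd haT hbT
  | @tail c d _ h ih =>
    by_cases hc : c ∈ T
    · exact ⟨c, h.2.1, hc, d, h.2.2, hbT, h.1⟩
    · exact ih hc

theorem ConnectedOn.subset_componentIn {S T : Set V} (hS : ConnectedOn G S) (hST : S ⊆ T) {a b : V}
    (hb : b ∈ S) (hba : b ∈ componentIn G T a) : S ⊆ componentIn G T a := fun c hc =>
  Relation.ReflTransGen.trans hba (reflTransGen_stepIn_mono hST (hS b hb c hc))

/-! ### Drawings of vertex sets -/

namespace PlaneEmbedding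

/-- The part of the drawing that belongs to the subgraph induced on `S`. -/
def draw (E : PlaneEmbedding G) (S : Set V) : Set ℂ :=
  E.point '' S ∪ ⋃ e ∈ {e : Sym2 V | e ∈ G.edgeSet ∧ ∀ v ∈ e, v ∈ S}, E.arc e

theorem draw_mono (E : PlaneEmbedding G) {S T : Set V} (h : S ⊆ T) : E.draw S ⊆ E.draw T :=
  Set.union_subset_union (Set.image_mono h)
    (Set.biUnion_subset_biUnion_left fun _ he => ⟨he.1, fun v hv => h (he.2 v hv)⟩)

theorem draw_subset_support (E : PlaneEmbedding G) (S : Set V) : E.draw S ⊆ E.support :=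
  Set.union_subset_union (Set.image_subset_range _ _)
    (Set.biUnion_subset_biUnion_left fun _ he => he.1)

theorem isCompact_arc (E : PlaneEmbedding G) {e : Sym2 V} (he : e ∈ G.edgeSet) :
    IsCompact (E.arc e) := by
  induction e with
  | _ u v =>
    obtain ⟨γ, -, hγ⟩ := E.isPlaneArc u v he
    rw [← hγ]
    exact isCompact_range γ.continuous

theorem isCompact_draw [Finite V] (E : PlaneEmbedding G) (S : Set V) : IsCompact (E.draw S) :=
  ((Set.toFinite _).isCompact).union
    ((Set.toFinite _).isCompact_biUnion fun _ he => E.isCompact_arc he.1)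

theorem isCompact_support [Finite V] (E : PlaneEmbedding G) : IsCompact E.support :=
  ((Set.finite_range _).isCompact).union
    ((Set.toFinite _).isCompact_biUnion fun _ he => E.isCompact_arc he)

theorem mem_of_point_mem_arc (E : PlaneEmbedding G) {e : Sym2 V} (he : e ∈ G.edgeSet) {w : V}
    (hw : E.point w ∈ E.arc e) : w ∈ e := by
  induction e with
  | _ u v => simpa using E.eq_or_eq_of_point_mem_arc u v w he hw

theorem point_mem_draw_iff (E : PlaneEmbedding G) {S : Set V} {w : V} :
    E.point w ∈ E.draw S ↔ w ∈ S := by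
  refine ⟨?_, fun h => .inl ⟨w, h, rfl⟩⟩
  rintro (⟨v, hv, h⟩ | h)
  · exact E.point_injective h ▸ hv
  · simp only [Set.mem_iUnion] at h
    obtain ⟨e, he, hw⟩ := h
    exact he.2 w (E.mem_of_point_mem_arc he.1 hw)

/-- Arcs of different edges meet only in vertex points, and a vertex point lies only in drawings of
sets containing that vertex. -/
theorem disjoint_draw (E : PlaneEmbedding G) {S T : Set V} (h : Disjoint S T) :
    Disjoint (E.draw S) (E.draw T) := by
  rw [Set.disjoint_left] at h ⊢
  have hpt : ∀ w, E.point w ∈ E.draw S → E.point w ∉ E.draw T := fun w hS hT =>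
    h (E.point_mem_draw_iff.1 hS) (E.point_mem_draw_iff.1 hT)
  intro z hS hT
  rcases hS with ⟨v, hv, rfl⟩ | hS'
  · exact hpt v (.inl ⟨v, hv, rfl⟩) hT
  rcases hT with ⟨v, hv, rfl⟩ | hT'
  · exact hpt v (.inr hS') (.inl ⟨v, hv, rfl⟩)
  have hS := hS'
  have hT := hT'
  simp only [Set.mem_iUnion] at hS' hT'
  obtain ⟨e, he, hze⟩ := hS'
  obtain ⟨f, hf, hzf⟩ := hT'
  have hef : e ≠ f := by
    rintro rfl
    induction e with
    | _ u v => exact h (he.2 u (by simp)) (hf.2 u (by simp))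
  obtain ⟨w, rfl⟩ := E.arc_inter_arc_subset e he.1 f hf.1 hef ⟨hze, hzf⟩
  exact hpt w (.inr hS) (.inr hT)

theorem joinedIn_draw (E : PlaneEmbedding G) {S : Set V} {a b : V} (ha : a ∈ S)
    (h : Relation.ReflTransGen (StepIn G S) a b) :
    JoinedIn (E.draw S) (E.point a) (E.point b) := by
  induction h with
  | refl => exact JoinedIn.refl (E.point_mem_draw_iff.2 ha)
  | @tail c d _ h ih =>
    obtain ⟨γ, -, hγ⟩ := E.isPlaneArc c d h.1
    refine ih.trans ⟨γ, fun t => .inr ?_⟩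
    refine Set.mem_biUnion (x := s(c, d)) ⟨h.1, ?_⟩ (hγ ▸ ⟨t, rfl⟩)
    intro v hv
    rcases Sym2.mem_iff.1 hv with rfl | rfl
    exacts [h.2.1, h.2.2]

end PlaneEmbedding

/-! ### Adding an apex in the outer face -/

theorem isPreconnected_norm_gt (R : ℝ) : IsPreconnected {z : ℂ | R < ‖z‖} := by
  have : {z : ℂ | R < ‖z‖} =
      (fun p : ℝ × ℝ => (p.1 : ℂ) * Complex.exp (p.2 * Complex.I)) '' (Set.Ioi R ×ˢ Set.univ) := by
    ext z
    constructor
    · intro hz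
      exact ⟨(‖z‖, z.arg), ⟨hz, trivial⟩, Complex.norm_mul_exp_arg_mul_I z⟩
    · rintro ⟨⟨r, t⟩, ⟨hr, -⟩, rfl⟩
      have hr : R < r := hr
      simp only [Set.mem_ofPred_eq, norm_mul, Complex.norm_exp_ofReal_mul_I, mul_one,
        Complex.norm_real, Real.norm_eq_abs]
      exact hr.trans_le (le_abs_self r)
  rw [this]
  exact (isPreconnected_Ioi.prod isPreconnected_univ).image _ (by fun_prop)

namespace PlaneEmbedding

/-- If all vertices lie on the outer face, then some point can be joined to each vertex without
meeting the drawing of the other vertices and the edges between them. -/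
theorem exists_apex [Finite V] (E : PlaneEmbedding G)
    (hE : ∀ v, E.point v ∈ frontier E.outerFace) :
    ∃ p, ∀ v, JoinedIn (E.draw {v}ᶜ)ᶜ (E.point v) p := by
  obtain ⟨R, hR⟩ := E.isCompact_support.isBounded.subset_closedBall 0
  set R' := max R 0
  have hout : {z : ℂ | R' < ‖z‖} ⊆ E.supportᶜ := fun z hz hzs => by
    have := hR hzs
    rw [mem_closedBall_zero_iff] at this
    exact (lt_irrefl _ ((le_max_left R 0).trans_lt hz |>.trans_le this))
  have hopen : IsOpen E.supportᶜ := E.isCompact_support.isClosed.isOpen_compl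
  let p : ℂ := (R' + 1 : ℝ)
  have hp : p ∈ {z : ℂ | R' < ‖z‖} := by
    have : 0 ≤ R' := le_max_right _ _
    simp only [p, Set.mem_ofPred_eq, Complex.norm_real, Real.norm_eq_abs]
    exact (lt_add_one _).trans_le (le_abs_self _)
  -- The outside of a disc around the drawing is connected, so every unbounded component is that of
  -- `p`.
  have hface : E.outerFace ⊆ connectedComponentIn E.supportᶜ p := by
    rintro z ⟨hz, hunb⟩
    obtain ⟨w, hw, hwR⟩ : ∃ w ∈ connectedComponentIn E.supportᶜ z, R' < ‖w‖ := by
      by_contra! h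
      exact hunb ((Metric.isBounded_closedBall (x := (0 : ℂ)) (r := R')).subset fun w hw =>
        mem_closedBall_zero_iff.2 (h w hw))
    have hwp : w ∈ connectedComponentIn E.supportᶜ p :=
      (isPreconnected_norm_gt R').subset_connectedComponentIn hp hout hwR
    rw [connectedComponentIn_eq hwp, ← connectedComponentIn_eq hw]
    exact mem_connectedComponentIn hz
  have hpath : IsPathConnected (connectedComponentIn E.supportᶜ p) :=
    hopen.connectedComponentIn.isConnected_iff_isPathConnected.1
      (isConnected_connectedComponentIn_iff.2 (hout hp))
  refine ⟨p, fun v => ?_⟩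
  -- A small disc around the vertex misses the drawing of the others and, by the frontier
  -- hypothesis, reaches the outer face.
  have hclosed := (E.isCompact_draw {v}ᶜ).isClosed
  obtain ⟨ε, hε, hball⟩ := Metric.isOpen_iff.1 hclosed.isOpen_compl (E.point v)
    (fun h => E.point_mem_draw_iff.1 h rfl)
  obtain ⟨z, hz, hzv⟩ := Metric.mem_closure_iff.1 (frontier_subset_closure (hE v)) ε hε
  have h1 : JoinedIn (Metric.ball (E.point v) ε) (E.point v) z :=
    (Metric.isPathConnected_ball hε).joinedIn _ (Metric.mem_ball_self hε) _
      (by rwa [Metric.mem_ball, dist_comm])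
  have h2 := hpath.joinedIn z (hface hz) p (mem_connectedComponentIn (hout hp))
  exact (h1.mono hball).trans (h2.mono ((connectedComponentIn_subset _ _).trans
    (Set.compl_subset_compl.2 (E.draw_subset_support _))))

/-- Disjoint connected vertex sets of an outerplanar drawing, together with one further vertex `o`
in the outer face, yield a drawing in which independent edges are disjoint. -/
theorem exists_drawing [Finite V] [Nonempty V] (E : PlaneEmbedding G)
    (hE : ∀ v, E.point v ∈ frontier E.outerFace) {m : ℕ} (o : Fin m) (X : Fin m → Set V)
    (hne : ∀ i, i ≠ o → (X i).Nonempty) (hconn : ∀ i, i ≠ o → ConnectedOn G (X i))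
    (hdisj : ∀ i j, i ≠ j → i ≠ o → j ≠ o → Disjoint (X i) (X j)) :
    ∃ (P : Fin m → ℂ) (γ : ∀ i j, Path (P i) (P j)), ∀ i j k l,
      i ≠ k → i ≠ l → j ≠ k → j ≠ l → i ≠ o → k ≠ o →
      (j = o ∨ AdjacentSets G (X i) (X j)) → (l = o ∨ AdjacentSets G (X k) (X l)) →
      Disjoint (Set.range (γ i j)) (Set.range (γ k l)) := by
  classical
  obtain ⟨p, hp⟩ := E.exists_apex hE
  have hx : ∀ i, ∃ x, i ≠ o → x ∈ X i := fun i => by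
    by_cases h : i = o
    · exact ⟨Classical.arbitrary V, fun h' => absurd h h'⟩
    · exact (hne i h).imp fun _ hx _ => hx
  choose x hx using hx
  -- Each set is contracted to its representative `x i`; the index `o` becomes the apex.
  obtain ⟨P, hPo, hP⟩ : ∃ P : Fin m → ℂ, P o = p ∧ ∀ i, i ≠ o → P i = E.point (x i) :=
    ⟨Function.update (fun i => E.point (x i)) o p, by simp, fun i hi => by simp [hi]⟩
  have hγ : ∀ i j, ∃ γ : Path (P i) (P j),
      (i ≠ o → j ≠ o → AdjacentSets G (X i) (X j) → Set.range γ ⊆ E.draw (X i ∪ X j)) ∧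
      (i ≠ o → j = o → Disjoint (Set.range γ) (E.draw {x i}ᶜ)) := by
    intro i j
    by_cases hi : i = o
    · exact ⟨(PathConnectedSpace.joined _ _).somePath, fun h => absurd hi h, fun h => absurd hi h⟩
    by_cases hj : j = o
    · obtain ⟨γ, hγ⟩ : JoinedIn (E.draw {x i}ᶜ)ᶜ (P i) (P j) := by
        rw [hP i hi, hj, hPo]; exact hp (x i)
      refine ⟨γ, fun _ h => absurd hj h, fun _ _ => Set.disjoint_left.2 ?_⟩
      rintro _ ⟨t, rfl⟩
      exact hγ t
    by_cases ha : AdjacentSets G (X i) (X j)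
    · obtain ⟨γ, hγ⟩ : JoinedIn (E.draw (X i ∪ X j)) (P i) (P j) := by
        rw [hP i hi, hP j hj]
        exact E.joinedIn_draw (.inl (hx i hi))
          ((hconn i hi).union (hconn j hj) ha _ (.inl (hx i hi)) _ (.inr (hx j hj)))
      refine ⟨γ, fun _ _ _ => ?_, fun _ h => absurd h hj⟩
      rintro _ ⟨t, rfl⟩
      exact hγ t
    · exact ⟨(PathConnectedSpace.joined _ _).somePath, fun _ _ h => absurd h ha,
        fun _ h => absurd h hj⟩
  choose γ hγ hγo using hγ
  -- An apex arc from `x i` avoids the drawing of any vertex set that omits `x i`.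
  have hcross : ∀ i k l, i ≠ k → i ≠ l → i ≠ o → k ≠ o → l ≠ o → AdjacentSets G (X k) (X l) →
      Disjoint (Set.range (γ i o)) (Set.range (γ k l)) := by
    intro i k l hik hil hi hk hl ha
    refine (hγo i o hi rfl).mono_right ((hγ k l hk hl ha).trans (E.draw_mono ?_))
    rintro v (hv | hv) rfl
    · exact Set.disjoint_left.1 (hdisj i k hik hi hk) (hx i hi) hv
    · exact Set.disjoint_left.1 (hdisj i l hil hi hl) (hx i hi) hv
  refine ⟨P, γ, fun i j k l hik hil hjk hjl hi hk hij hkl => ?_⟩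
  by_cases hj : j = o
  · subst hj
    exact hcross i k l hik hil hi hk hjl.symm (hkl.resolve_left hjl.symm)
  have hij' := hij.resolve_left hj
  by_cases hl : l = o
  · subst hl
    exact (hcross k i j hik.symm hjk.symm hk hi hj hij').symm
  refine (E.disjoint_draw ?_).mono (hγ i j hi hj hij') (hγ k l hk hl (hkl.resolve_left hl))
  simp only [Set.disjoint_union_left, Set.disjoint_union_right]
  exact ⟨⟨hdisj i k hik hi hk, hdisj j k hjk hj hk⟩, hdisj i l hil hi hl, hdisj j l hjl hj hl⟩

end PlaneEmbedding

/-! ### Excluded minors of outerplanar graphs -/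

/-- An outerplanar graph has no `K₄` minor. -/
theorem IsOuterplanar.no_complete_four_minor [Finite V] (hG : IsOuterplanar G) (X : Fin 4 → Set V)
    (hconn : ∀ i, ConnectedOn G (X i)) (hdisj : ∀ i j, i < j → Disjoint (X i) (X j))
    (hadj : ∀ i j, i < j → AdjacentSets G (X i) (X j)) : False := by
  obtain ⟨E, hE⟩ := hG
  have hadj' : ∀ i j, i ≠ j → AdjacentSets G (X i) (X j) := fun i j h =>
    (lt_or_gt_of_ne h).elim (hadj i j) fun h => (hadj j i h).symm
  have hdisj' : ∀ i j, i ≠ j → Disjoint (X i) (X j) := fun i j h =>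
    (lt_or_gt_of_ne h).elim (hdisj i j) fun h => (hdisj j i h).symm
  have : Nonempty V := ⟨(hadj 0 1 (by decide)).choose⟩
  have hne : ∀ i, (X i).Nonempty := fun i => by
    obtain ⟨j, hj⟩ := exists_ne i
    obtain ⟨a, ha, -⟩ := hadj' i j hj.symm
    exact ⟨a, ha⟩
  have hcast : ∀ i : Fin 5, i ≠ Fin.last 4 → ∃ j : Fin 4, i = j.castSucc := fun i hi =>
    ⟨i.castPred hi, by simp⟩
  obtain ⟨P, γ, h⟩ := E.exists_drawing hE (Fin.last 4) (Fin.snoc (α := fun _ => Set V) X ∅)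
    (fun i hi => by obtain ⟨i, rfl⟩ := hcast i hi; simpa using hne i)
    (fun i hi => by obtain ⟨i, rfl⟩ := hcast i hi; simpa using hconn i)
    (fun i j hij hi hj => by
      obtain ⟨i, rfl⟩ := hcast i hi
      obtain ⟨j, rfl⟩ := hcast j hj
      simpa using hdisj' i j (by simpa using hij))
  have hedge : ∀ i j : Fin 5, i < j → i ≠ Fin.last 4 ∧ (j = Fin.last 4 ∨
      AdjacentSets G (Fin.snoc (α := fun _ => Set V) X ∅ i)
        (Fin.snoc (α := fun _ => Set V) X ∅ j)) := by
    intro i j hij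
    have hi := (hij.trans_le (Fin.le_last j)).ne
    refine ⟨hi, or_iff_not_imp_left.2 fun hj => ?_⟩
    obtain ⟨i, rfl⟩ := hcast i hi
    obtain ⟨j, rfl⟩ := hcast j hj
    simpa using hadj i j (by simpa using hij)
  exact not_disjoint_drawing_five P γ fun i j k l hij hkl a b c d =>
    h i j k l a b c d (hedge i j hij).1 (hedge k l hkl).1 (hedge i j hij).2 (hedge k l hkl).2

/-- An outerplanar graph has no `K₂,₃` minor. -/
theorem IsOuterplanar.no_complete_bipartite_minor [Finite V] (hG : IsOuterplanar G)
    (A : Fin 2 → Set V) (B : Fin 3 → Set V)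
    (hA : ∀ i, ConnectedOn G (A i)) (hB : ∀ i, ConnectedOn G (B i))
    (hAA : Disjoint (A 0) (A 1)) (hBB : ∀ i j, i < j → Disjoint (B i) (B j))
    (hAB : ∀ i j, Disjoint (A i) (B j))
    (hadj : ∀ i j, AdjacentSets G (A i) (B j)) : False := by
  obtain ⟨E, hE⟩ := hG
  have : Nonempty V := ⟨(hadj 0 1).choose⟩
  have hAne : ∀ i, (A i).Nonempty := fun i => by
    obtain ⟨a, ha, -⟩ := hadj i 0; exact ⟨a, ha⟩
  have hBne : ∀ i, (B i).Nonempty := fun i => by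
    obtain ⟨a, ha, -⟩ := (hadj 0 i).symm; exact ⟨a, ha⟩
  have hd : ∀ i j : Fin 6, i < j → j ≠ 5 → Disjoint
      ((![A 0, A 1, B 0, B 1, B 2, ∅] : Fin 6 → Set V) i)
      ((![A 0, A 1, B 0, B 1, B 2, ∅] : Fin 6 → Set V) j) := by
    intro i j hij hj
    fin_cases i <;> fin_cases j <;> simp [hAA, hBB, hAB] at hij hj ⊢
  obtain ⟨P, γ, h⟩ := E.exists_drawing hE 5 ![A 0, A 1, B 0, B 1, B 2, ∅]
    (fun i hi => by fin_cases i <;> simp [hAne, hBne] at hi ⊢)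
    (fun i hi => by fin_cases i <;> simp [hA, hB] at hi ⊢)
    (fun i j hij hi hj => (lt_or_gt_of_ne hij).elim (fun h => hd i j h hj)
      fun h => (hd j i h hi).symm)
  have hedge : ∀ i j : Fin 6,
      ((i = 0 ∨ i = 1) ∧ (j = 2 ∨ j = 3 ∨ j = 4) ∨ (i = 2 ∨ i = 3 ∨ i = 4) ∧ j = 5) →
      i ≠ 5 ∧ (j = 5 ∨ AdjacentSets G ((![A 0, A 1, B 0, B 1, B 2, ∅] : Fin 6 → Set V) i)
        ((![A 0, A 1, B 0, B 1, B 2, ∅] : Fin 6 → Set V) j)) := by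
    rintro i j (⟨rfl | rfl, rfl | rfl | rfl⟩ | ⟨rfl | rfl | rfl, rfl⟩) <;> simp [hadj]
  exact not_disjoint_drawing_three_three P γ fun i j k l _ _ a b c d hij hkl =>
    h i j k l a b c d (hedge i j hij).1 (hedge k l hkl).1 (hedge i j hij).2 (hedge k l hkl).2

/-! ### The choice of the next vertex -/

theorem AdjacentSets.mono {S S' T T' : Set V} (h : AdjacentSets G S T) (hS : S ⊆ S') (hT : T ⊆ T') :
    AdjacentSets G S' T' := by
  obtain ⟨a, ha, b, hb, hab⟩ := h
  exact ⟨a, hS ha, b, hT hb, hab⟩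

theorem ConnectedOn.exists_adj_of_component {T : Set V} (hT : ConnectedOn G T) {u v : V}
    (hu : u ∈ T) (hv : v ∈ T \ {u}) : ∃ c ∈ componentIn G (T \ {u}) v, G.Adj c u := by
  have hsub := componentIn_subset (G := G) hv
  obtain ⟨c, -, hc, d, hd, hdc, hcd⟩ :=
    hT.exists_exit hv.1 (mem_componentIn_self (G := G) (S := T \ {u})) hu fun h => (hsub h).2 rfl
  refine ⟨c, hc, ?_⟩
  by_cases h : d = u
  · exact h ▸ hcd
  · exact absurd (mem_componentIn_of_adj hc (hsub hc) ⟨hd, h⟩ hcd) hdc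

/-- If `T` is a connected territory that is left only through `x` and `u`, which are also joined
outside `T` by `X`, then some neighbour `u'` of `u` in `T` separates `u` from `x` within `T`. -/
theorem IsOuterplanar.exists_separating_neighbor [Finite V] (hG : IsOuterplanar G) {T X : Set V}
    {u x : V} (hT : ConnectedOn G T) (hX : ConnectedOn G X) (hXT : Disjoint X T) (hx : x ∈ X)
    (hu : u ∉ X) (huT : u ∉ T) (huX : AdjacentSets G {u} X) (hnb : ∃ w ∈ T, G.Adj u w) :
    ∃ u' ∈ T, G.Adj u u' ∧ ∀ v ∈ T \ {u'}, AdjacentSets G {u} (componentIn G (T \ {u'}) v) →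
      ¬ AdjacentSets G {x} (componentIn G (T \ {u'}) v) := by
  have hcomp : ∀ {u' v}, v ∈ T \ {u'} → componentIn G (T \ {u'}) v ⊆ T := fun hv =>
    (componentIn_subset hv).trans Set.sdiff_subset
  -- A component touching `u` and `x` but disjoint from `U'` would form a `K₄` minor with `{u}`, `X`
  -- and `U'`.
  have four : ∀ (U' : Set V) (u' v : V), u' ∈ U' → u' ∈ T → U' ⊆ T → ConnectedOn G U' →
      G.Adj u u' → AdjacentSets G {x} U' → v ∈ T \ {u'} →
      Disjoint U' (componentIn G (T \ {u'}) v) → AdjacentSets G {u} (componentIn G (T \ {u'}) v) →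
      AdjacentSets G {x} (componentIn G (T \ {u'}) v) → False := by
    intro U' u' v hu' hu'T hU'T hU' huu' hxU' hv hd h1 h2
    have hxX : {x} ⊆ X := Set.singleton_subset_iff.2 hx
    refine hG.no_complete_four_minor ![{u}, X, U', componentIn G (T \ {u'}) v] ?_ ?_ ?_
    · intro i
      fin_cases i
      exacts [connectedOn_singleton u, hX, hU', connectedOn_componentIn _ _]
    · have d1 : Disjoint {u} X := Set.disjoint_singleton_left.2 hu
      have d2 : Disjoint {u} U' := Set.disjoint_singleton_left.2 fun h => huT (hU'T h)
      have d3 : Disjoint {u} (componentIn G (T \ {u'}) v) :=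
        Set.disjoint_singleton_left.2 fun h => huT (hcomp hv h)
      have d4 : Disjoint X U' := hXT.mono_right hU'T
      have d5 : Disjoint X (componentIn G (T \ {u'}) v) := hXT.mono_right (hcomp hv)
      intro i j hij
      fin_cases i <;> fin_cases j <;> first | exact absurd hij (by decide) | assumption
    · have a1 : AdjacentSets G {u} U' := ⟨u, rfl, u', hu', huu'⟩
      have a2 : AdjacentSets G X U' := hxU'.mono hxX subset_rfl
      have a3 : AdjacentSets G X (componentIn G (T \ {u'}) v) := h2.mono hxX subset_rfl
      have a4 : AdjacentSets G U' (componentIn G (T \ {u'}) v) := by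
        obtain ⟨c, hc, hcu⟩ := hT.exists_adj_of_component hu'T hv
        exact ⟨u', hu', c, hc, hcu.symm⟩
      intro i j hij
      fin_cases i <;> fin_cases j <;> first | exact absurd hij (by decide) | assumption
  obtain ⟨u₀, hu₀, huu₀⟩ := hnb
  by_cases hx1 : ∃ z ∈ T, ¬ G.Adj u z ∧ G.Adj x z
  · obtain ⟨z, hzT, huz, hxz⟩ := hx1
    have hz : z ∈ {z ∈ T | ¬ G.Adj u z} := ⟨hzT, huz⟩
    -- `W` is a maximal connected part of `T` around `z` without neighbours of `u`, so any exit from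
    -- `W` within `T` leads to a neighbour of `u`; such an exit serves as `u'`.
    set W := componentIn G {z ∈ T | ¬ G.Adj u z} z with hWdef
    have hWsub : W ⊆ {z ∈ T | ¬ G.Adj u z} := componentIn_subset hz
    have hW : ConnectedOn G W := connectedOn_componentIn _ _
    have hzW : z ∈ W := mem_componentIn_self
    have hWT : W ⊆ T := fun w hw => (hWsub hw).1
    obtain ⟨c, -, hc, u', hu', hu'W, hcu'⟩ := hT.exists_exit hzT hzW hu₀
      fun h => (hWsub h).2 huu₀
    have huu' : G.Adj u u' := by
      by_contra h
      exact hu'W (mem_componentIn_of_adj hc (hWsub hc) ⟨hu', h⟩ hcu')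
    refine ⟨u', hu', huu', fun v hv h1 h2 => ?_⟩
    set T' := componentIn G (T \ {u'}) v with hT'def
    have hT' : ConnectedOn G T' := connectedOn_componentIn _ _
    by_cases hd : Disjoint W T'
    · refine four (W ∪ {u'}) u' v (.inr rfl) hu'
        (Set.union_subset hWT (Set.singleton_subset_iff.2 hu'))
        (hW.union (connectedOn_singleton u') ⟨c, hc, u', rfl, hcu'⟩) huu'
        ⟨x, rfl, z, .inl hzW, hxz⟩ hv ?_ h1 h2
      refine Set.disjoint_union_left.2 ⟨hd, Set.disjoint_singleton_left.2 fun h => ?_⟩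
      exact (componentIn_subset hv h).2 rfl
    -- Now `W` lies inside the component `T'`. A piece `Q` of `T' \ W` joins `u` to `W`, as do `u'`
    -- and `X`: a `K₂,₃` minor.
    · obtain ⟨w, hwW, hwT'⟩ := Set.not_disjoint_iff.1 hd
      have hWT' : W ⊆ T' := hW.subset_componentIn
        (Set.subset_sdiff_singleton hWT hu'W) hwW hwT'
      obtain ⟨_, hmem, u₂, hu₂, huu₂⟩ := h1
      rw [Set.mem_singleton_iff.1 hmem] at huu₂
      have hu₂W : u₂ ∉ W := fun h => (hWsub h).2 huu₂
      set Q := componentIn G (T' \ W) u₂ with hQdef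
      have hQsub : Q ⊆ T' \ W := componentIn_subset ⟨hu₂, hu₂W⟩
      obtain ⟨q, -, hq, d, hd, hdQ, hqd⟩ := hT'.exists_exit hu₂
        (mem_componentIn_self (G := G) (S := T' \ W)) hwT' fun h => (hQsub h).2 hwW
      have hdW : d ∈ W := by
        by_contra h
        exact hdQ (mem_componentIn_of_adj hq (hQsub hq) ⟨hd, h⟩ hqd)
      have hQT : Q ⊆ T := fun a ha => hcomp hv (hQsub ha).1
      have huW : Disjoint {u} W := Set.disjoint_singleton_left.2 fun h => huT (hWT h)
      refine hG.no_complete_bipartite_minor ![{u}, W] ![Q, {u'}, X] ?_ ?_ huW ?_ ?_ ?_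
      · intro i
        fin_cases i
        exacts [connectedOn_singleton u, hW]
      · intro i
        fin_cases i
        exacts [connectedOn_componentIn _ _, connectedOn_singleton u', hX]
      · have d1 : Disjoint Q {u'} := Set.disjoint_singleton_right.2 fun h =>
          (componentIn_subset hv (hQsub h).1).2 rfl
        have d2 : Disjoint Q X := (hXT.mono_right hQT).symm
        have d3 : Disjoint {u'} X := (hXT.mono_right (Set.singleton_subset_iff.2 hu')).symm
        intro i j hij
        fin_cases i <;> fin_cases j <;> first | exact absurd hij (by decide) | assumption
      · have d1 : Disjoint {u} Q := Set.disjoint_singleton_left.2 fun h => huT (hQT h)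
        have d2 : Disjoint {u} {u'} := Set.disjoint_singleton.2 huu'.ne
        have d3 : Disjoint {u} X := Set.disjoint_singleton_left.2 hu
        have d4 : Disjoint W Q := Set.disjoint_right.2 fun a ha => (hQsub ha).2
        have d5 : Disjoint W {u'} := Set.disjoint_singleton_right.2 hu'W
        have d6 : Disjoint W X := (hXT.mono_right hWT).symm
        intro i j
        fin_cases i <;> fin_cases j <;> assumption
      · have a1 : AdjacentSets G {u} Q := ⟨u, rfl, u₂, mem_componentIn_self, huu₂⟩
        have a2 : AdjacentSets G {u} {u'} := ⟨u, rfl, u', rfl, huu'⟩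
        have a3 : AdjacentSets G W Q := ⟨d, hdW, q, hq, hqd.symm⟩
        have a4 : AdjacentSets G W {u'} := ⟨c, hc, u', rfl, hcu'⟩
        have a5 : AdjacentSets G W X := ⟨z, hzW, x, hx, hxz.symm⟩
        intro i j
        fin_cases i <;> fin_cases j <;> assumption
  · push Not at hx1
    by_cases hx2 : ∃ z ∈ T, G.Adj x z
    · obtain ⟨z, hz, hxz⟩ := hx2
      have huz : G.Adj u z := by
        by_contra h
        exact hx1 z hz h hxz
      refine ⟨z, hz, huz, fun v hv h1 h2 => ?_⟩
      exact four {z} z v rfl hz (Set.singleton_subset_iff.2 hz) (connectedOn_singleton z) huz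
        ⟨x, rfl, z, rfl, hxz⟩ hv
        (Set.disjoint_singleton_left.2 fun h => (componentIn_subset hv h).2 rfl) h1 h2
    · refine ⟨u₀, hu₀, huu₀, fun v hv _ h2 => hx2 ?_⟩
      obtain ⟨_, rfl, b, hb, hab⟩ := h2
      exact ⟨b, hcomp hv hb, hab⟩

/-! ### The strategy of two cops -/

theorem CopsForceCapture.swap {c : Fin 2 → V} {r : V} (h : CopsForceCapture G c r) :
    CopsForceCapture G (c ∘ Equiv.swap 0 1) r := by
  induction h with
  | captured c r i h => exact .captured _ _ (Equiv.swap 0 1 i) (by simpa using h)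
  | capture c c' r hc i h =>
    exact .capture _ (c' ∘ Equiv.swap 0 1) _ (fun j => hc _) (Equiv.swap 0 1 i) (by simpa using h)
  | move c c' r hc hr _ ih => exact .move _ (c' ∘ Equiv.swap 0 1) _ (fun j => hc _) hr ih

theorem CopsForceCapture.swap_pair {a b r : V} (h : CopsForceCapture G ![a, b] r) :
    CopsForceCapture G ![b, a] r := by
  convert h.swap using 1
  ext i
  fin_cases i <;> rfl

/-- One round in which the cops step from `a`, `b` to `a'`, `b'`. Afterwards they threaten both
their old and their new vertices. -/
theorem copsForceCapture_of_round {a a' b b' r : V} (ha : G.Adj a a') (hb : G.Adj b b')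
    (hr : ∃ w, G.Adj r w)
    (h : ∀ w, G.Adj r w →
      w = a ∨ w = a' ∨ w = b ∨ w = b' ∨ CopsForceCapture G ![a', b'] w) :
    CopsForceCapture G ![a, b] r := by
  have hback : ∀ j, G.Adj ((![a', b'] : Fin 2 → V) j) ((![a, b] : Fin 2 → V) j) := by
    intro j
    fin_cases j
    exacts [ha.symm, hb.symm]
  refine .move _ ![a', b'] _ (fun j => (hback j).symm) hr fun w hw => ?_
  rcases h w hw with rfl | rfl | rfl | rfl | h
  · exact .capture _ _ _ hback 0 rfl
  · exact .captured _ _ 0 rfl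
  · exact .capture _ _ _ hback 1 rfl
  · exact .captured _ _ 1 rfl
  · exact h

/-- One cop, oscillating on the edge `xy`, keeps the robber in the territory `T`, and this suffices
for two cops to win. -/
def EdgeGuardWins (G : SimpleGraph V) (T : Set V) : Prop :=
  ∀ x y, G.Adj x y → x ∉ T → y ∉ T → ConnectedOn G T →
    (∀ v ∈ T, ∀ w, G.Adj v w → w ∈ T ∨ w = x ∨ w = y) →
    ∀ a, a = x ∨ a = y → ∀ b, ∀ r ∈ T, CopsForceCapture G ![a, b] r

/-- One cop, oscillating on the edge `xy`, and the other cop at `u` keep the robber in the territory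
`T`, around which `X` joins `u` to `x`, and this suffices for the cops to win. -/
def PairGuardWins (G : SimpleGraph V) (T : Set V) : Prop :=
  ∀ x y u, ∀ X : Set V, G.Adj x y → u ∉ T → ConnectedOn G T →
    (∀ v ∈ T, ∀ w, G.Adj v w → w ∈ T ∨ w = x ∨ w = u) → (∃ w ∈ T, G.Adj u w) →
    ConnectedOn G X → Disjoint X T → x ∈ X → u ∉ X → AdjacentSets G {u} X →
    ∀ a, a = x ∨ a = y → ∀ r ∈ T, CopsForceCapture G ![a, u] r

/-- In one round the cop covers the vertex she leaves and the one she enters, so the phase of the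
oscillation never matters. -/
theorem exists_other_end {x y a : V} (hxy : G.Adj x y) (ha : a = x ∨ a = y) :
    ∃ a', (a' = x ∨ a' = y) ∧ G.Adj a a' ∧ (x = a ∨ x = a') ∧ (y = a ∨ y = a') := by
  rcases ha with rfl | rfl
  · exact ⟨y, .inr rfl, hxy, .inl rfl, .inr rfl⟩
  · exact ⟨x, .inl rfl, hxy.symm, .inr rfl, .inl rfl⟩

/-- The cop steps from `u` to the separating neighbour `u'`. If the robber's component touches `x`,
it does not touch `u`, and the pair guard continues with `u'` and `X ∪ {u}`. Otherwise its exits are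
among `u` and `u'`; the cop at `u'` then oscillates on that edge and the other cop is free. -/
theorem IsOuterplanar.pairGuardWins [Finite V] (hG : IsOuterplanar G)
    (hdeg : ∀ v, ∃ w, G.Adj v w) (T : Set V)
    (ih : ∀ T' : Set V, T'.ncard < T.ncard → EdgeGuardWins G T' ∧ PairGuardWins G T') :
    PairGuardWins G T := by
  intro x y u X hxy huT hT hcl hnb hX hXT hx hu huX a ha r hr
  obtain ⟨u', hu', huu', hsep⟩ :=
    hG.exists_separating_neighbor hT hX hXT hx hu huT huX hnb
  obtain ⟨a', ha', haa', hxa, -⟩ := exists_other_end hxy ha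
  refine copsForceCapture_of_round haa' huu' (hdeg r) fun w hrw => ?_
  rcases hcl r hr w hrw with hw | rfl | rfl
  · by_cases hwu : w = u'
    · exact .inr (.inr (.inr (.inl hwu)))
    refine .inr (.inr (.inr (.inr ?_)))
    have hw' : w ∈ T \ {u'} := ⟨hw, hwu⟩
    set T' := componentIn G (T \ {u'}) w with hT'def
    have hsub : T' ⊆ T \ {u'} := componentIn_subset hw'
    have hlt : T'.ncard < T.ncard := Set.ncard_lt_ncard
      ⟨hsub.trans Set.sdiff_subset, fun h => (hsub (h hu')).2 rfl⟩ (Set.toFinite _)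
    have hcl' : ∀ v ∈ T', ∀ z, G.Adj v z → z ∈ T' ∨ z = u' ∨ z = x ∨ z = u := by
      intro v hv z hvz
      rcases hcl v (hsub hv).1 z hvz with hz | hz | hz
      · by_cases h : z = u'
        · exact .inr (.inl h)
        · exact .inl (mem_componentIn_of_adj hv (hsub hv) ⟨hz, h⟩ hvz)
      · exact .inr (.inr (.inl hz))
      · exact .inr (.inr (.inr hz))
    have hT' : ConnectedOn G T' := connectedOn_componentIn _ _
    have hwT' : w ∈ T' := mem_componentIn_self
    have huT' : u ∉ T' := fun h => huT (hsub h).1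
    have hu'T' : u' ∉ T' := fun h => (hsub h).2 rfl
    by_cases hxT' : AdjacentSets G {x} T'
    · have hu2 : ¬ AdjacentSets G {u} T' := fun h => hsep w hw' h hxT'
      refine (ih T' hlt).2 x y u' (X ∪ {u}) hxy hu'T' hT' ?_ ?_
        (hX.union (connectedOn_singleton u) huX.symm) ?_ (.inl hx) ?_
        ⟨u', rfl, u, .inr rfl, huu'.symm⟩ a' ha' w hwT'
      · intro v hv z hvz
        rcases hcl' v hv z hvz with h | h | h | rfl
        · exact .inl h
        · exact .inr (.inr h)
        · exact .inr (.inl h)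
        · exact absurd ⟨z, rfl, v, hv, hvz.symm⟩ hu2
      · obtain ⟨c, hc, hcu⟩ := hT.exists_adj_of_component hu' hw'
        exact ⟨c, hc, hcu.symm⟩
      · exact Set.disjoint_union_left.2 ⟨hXT.mono_right (hsub.trans Set.sdiff_subset),
          Set.disjoint_singleton_left.2 huT'⟩
      · rintro (h | h)
        · exact Set.disjoint_left.1 hXT h hu'
        · exact huu'.ne h.symm
    · refine ((ih T' hlt).1 u u' huu' huT' hu'T' hT' ?_ u' (.inr rfl) a' w hwT').swap_pair
      intro v hv z hvz
      rcases hcl' v hv z hvz with h | h | rfl | h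
      · exact .inl h
      · exact .inr (.inr h)
      · exact absurd ⟨z, rfl, v, hv, hvz.symm⟩ hxT'
      · exact .inr (.inl h)
  · exact hxa.elim .inl fun h => .inr (.inl h)
  · exact .inr (.inr (.inl rfl))

/-- Connectedness gives an end of the guarded edge with a neighbour in `T`. The free cop walks there
while the other keeps oscillating; then the pair guard applies with that end as `u` and the opposite
end alone as `X`. -/
theorem PairGuardWins.edgeGuardWins (hconn : G.Connected) (hdeg : ∀ v, ∃ w, G.Adj v w) {T : Set V}
    (h : PairGuardWins G T) : EdgeGuardWins G T := by
  have key : ∀ x y, G.Adj x y → x ∉ T → y ∉ T → ConnectedOn G T →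
      (∀ v ∈ T, ∀ w, G.Adj v w → w ∈ T ∨ w = x ∨ w = y) → (∃ w ∈ T, G.Adj y w) →
      ∀ a, a = x ∨ a = y → ∀ b, ∀ r ∈ T, CopsForceCapture G ![a, b] r := by
    intro x y hxy hx hy hT hcl hnb a ha b
    have hreach : Relation.ReflTransGen G.Adj b y :=
      (SimpleGraph.reachable_iff_reflTransGen b y).1 (hconn.preconnected b y)
    induction hreach using Relation.ReflTransGen.head_induction_on generalizing a with
    | refl =>
      exact h x y y {x} hxy hy hT hcl hnb (connectedOn_singleton x)
        (Set.disjoint_singleton_left.2 hx) rfl hxy.ne' ⟨y, rfl, x, rfl, hxy.symm⟩ a ha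
    | head hbc _ ih =>
      intro r hr
      obtain ⟨a', ha', haa', hxa, hya⟩ := exists_other_end hxy ha
      refine copsForceCapture_of_round haa' hbc (hdeg r) fun w hrw => ?_
      rcases hcl r hr w hrw with hw | rfl | rfl
      · exact .inr (.inr (.inr (.inr (ih a' ha' w hw))))
      · exact hxa.elim .inl fun h => .inr (.inl h)
      · exact hya.elim .inl fun h => .inr (.inl h)
  intro x y hxy hx hy hT hcl a ha b r hr
  have huniv : ConnectedOn G Set.univ := fun a _ b _ =>
    Relation.ReflTransGen.mono (fun _ _ h => ⟨h, trivial, trivial⟩) _ _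
      ((SimpleGraph.reachable_iff_reflTransGen a b).1 (hconn.preconnected a b))
  obtain ⟨c, -, hc, d, -, hd, hcd⟩ := huniv.exists_exit trivial hr trivial hx
  rcases (hcl c hc d hcd).resolve_left hd with rfl | rfl
  · exact key y d hxy.symm hy hx hT (fun v hv w hvw => (hcl v hv w hvw).imp_right Or.symm)
      ⟨c, hc, hcd.symm⟩ a ha.symm b r hr
  · exact key x d hxy hx hy hT hcl ⟨c, hc, hcd.symm⟩ a ha b r hr

theorem IsOuterplanar.edgeGuardWins [Finite V] (hG : IsOuterplanar G) (hconn : G.Connected)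
    (hdeg : ∀ v, ∃ w, G.Adj v w) (T : Set V) : EdgeGuardWins G T ∧ PairGuardWins G T := by
  induction hn : T.ncard using Nat.strong_induction_on generalizing T with
  | _ n ih =>
    -- The pair guard uses both claims for smaller territories; the edge guard uses the pair guard
    -- on the same one.
    have hp := hG.pairGuardWins hdeg T fun T' hT' => ih _ (hn ▸ hT') T' rfl
    exact ⟨hp.edgeGuardWins hconn hdeg, hp⟩

theorem IsOuterplanar.copsHaveWinningStrategy_two [Finite V] (hG : IsOuterplanar G)
    (hconn : G.Connected) : CopsHaveWinningStrategy G 2 := by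
  obtain ⟨x⟩ := hconn.nonempty
  rcases subsingleton_or_nontrivial V with _ | _
  · exact ⟨![x, x], fun r => .captured _ _ 0 (Subsingleton.elim _ _)⟩
  have hdeg : ∀ v, ∃ w, G.Adj v w := hconn.preconnected.exists_adj_of_nontrivial
  obtain ⟨y, hxy⟩ := hdeg x
  refine ⟨![x, y], fun r => ?_⟩
  by_cases hrx : r = x
  · exact .captured _ _ 0 hrx.symm
  by_cases hry : r = y
  · exact .captured _ _ 1 hry.symm
  have hr : r ∈ ({x, y}ᶜ : Set V) := by simp [hrx, hry]
  have hsub := componentIn_subset (G := G) hr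
  refine (hG.edgeGuardWins hconn hdeg (componentIn G {x, y}ᶜ r)).1 x y hxy
    (fun h => hsub h (by simp)) (fun h => hsub h (by simp)) (connectedOn_componentIn _ _)
    (fun v hv w hvw => ?_) x (.inl rfl) y r mem_componentIn_self
  by_cases hw : w ∈ ({x, y}ᶜ : Set V)
  · exact .inl (mem_componentIn_of_adj hv (hsub hv) hw hvw)
  · exact .inr (not_not.1 hw)

end Graph

theorem mainTheorem1 {V : Type*} [Finite V] (G : SimpleGraph V) (hconn : G.Connected)
    (hG : IsOuterplanar G) : fullyActiveCopNumber G ≤ 2 :=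
  iInf₂_le 2 (hG.copsHaveWinningStrategy_two hconn)
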